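/- Let $\mathbb C^+=\{z\in\mathbb C:\operatorname{Im} z>0\}$ and let $C_b(X,\mathbb C)$ denote the bounded continuous complex-valued functions on $X$ with the supremum norm. Let $\mathrm{AP}$ (respectively $\mathrm{AP}^+$) be the uniform closure in $C_b(\mathbb R,\mathbb C)$ of the set of all functions $t\mapsto\sum_{j=1}^n a_j e^{i\lambda_j t}$ with $n\in\mathbb N$, $a_j\in\mathbb C$ and $\lambda_j\in\mathbb R$ (respectively $\lambda_j\ge 0$), and let $\mathrm{AP}^+_{\mathrm{hol}}$ be the uniform closure in $C_b(\mathbb C^+,\mathbb C)$ of the set of all functions $z\mapsto\sum_{j=1}^n a_j e^{i\lambda_j z}$ with $n\in\mathbb N$, $a_j\in\mathbb C$ and $\lambda_j\ge 0$. **Theorem.** Let $f$ be a bounded holomorphic function on $\mathbb C^+$ that has a continuous extension $f^*$ to $\mathbb R$ (that is, $f$ on $\mathbb C^+$ and $f^*$ on $\mathbb R$ together form a continuous function on the closed upper half-plane), and suppose that $f^*\in\mathrm{AP}$. Then for every $\lambda<0$ the Fourier–Bohr coefficient $$\widehat{f^*}(\lambda)=\lim_{|I|\to\infty}\frac1{|I|}\int_I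 f^*(t)e^{-i\lambda t}\,dt,$$ where $I$ runs through the compact intervals of $\mathbb R$, exists and equals $0$; moreover $f^*\in\mathrm{AP}^+$ and $f\in\mathrm{AP}^+_{\mathrm{hol}}$. -/

import Mathlib

open Filter Topology
open scoped BoundedContinuousFunction UpperHalfPlane Manifold

/-- The algebra `AP` of almost periodic functions on the real line: the uniform closure in
`C_b(ℝ, ℂ)` of the generalized trigonometric polynomials `t ↦ ∑ⱼ aⱼ e^{i λⱼ t}`, `λⱼ ∈ ℝ`. -/
def AP : Set (ℝ →ᵇ ℂ) :=
  closure {Q | ∃ (n : ℕ) (a : Fin n → ℂ) (l : Fin n → ℝ),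
    ∀ t : ℝ, Q t = ∑ j, a j * Complex.exp (Complex.I * (l j : ℂ) * (t : ℂ))}

/-- The analytic trace `AP⁺` of `AP`: the uniform closure in `C_b(ℝ, ℂ)` of the generalized
trigonometric polynomials with nonnegative frequencies. -/
def APPlus : Set (ℝ →ᵇ ℂ) :=
  closure {Q | ∃ (n : ℕ) (a : Fin n → ℂ) (l : Fin n → ℝ), (∀ j, 0 ≤ l j) ∧
    ∀ t : ℝ, Q t = ∑ j, a j * Complex.exp (Complex.I * (l j : ℂ) * (t : ℂ))}

/-- `AP⁺_hol`: the uniform closure in `C_b(ℂ⁺, ℂ)`, where `ℂ⁺` is the open upper half-plane, of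
the functions `z ↦ ∑ⱼ aⱼ e^{i λⱼ z}` with `λⱼ ≥ 0`. -/
def APPlusHol : Set (ℍ →ᵇ ℂ) :=
  closure {q | ∃ (n : ℕ) (a : Fin n → ℂ) (l : Fin n → ℝ), (∀ j, 0 ≤ l j) ∧
    ∀ z : ℍ, q z = ∑ j, a j * Complex.exp (Complex.I * (l j : ℂ) * (z : ℂ))}

/-- `H^∞(ℂ⁺)`: the bounded holomorphic functions on the open upper half-plane. -/
def HInfty : Set (ℍ →ᵇ ℂ) := {f | MDifferentiable 𝓘(ℂ) 𝓘(ℂ) (f : ℍ → ℂ)}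

/-- `fs` is the continuous extension of `f` to the boundary `ℝ` of the upper half-plane: `f` and
`fs` are the restrictions to `ℂ⁺` and to `ℝ` of one continuous function on the closed
upper half-plane. -/
def IsBoundaryExtension (f : ℍ → ℂ) (fs : ℝ → ℂ) : Prop :=
  ∃ F : ℂ → ℂ, ContinuousOn F {z : ℂ | 0 ≤ z.im} ∧
    (∀ z : ℍ, F (z : ℂ) = f z) ∧ ∀ x : ℝ, F (x : ℂ) = fs x

/-- The Fourier-Bohr coefficient of `f` at `l` exists and equals `c`: the averages
`|I|⁻¹ ∫_I f(t) e^{-i l t} dt` over compact intervals `I = [p.1, p.2]` tend to `c`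
as `|I| = p.2 - p.1` tends to infinity. -/
def HasFourierBohrCoeff (f : ℝ → ℂ) (l : ℝ) (c : ℂ) : Prop :=
  Tendsto (fun p : ℝ × ℝ => (((p.2 - p.1)⁻¹ : ℝ) : ℂ) *
      ∫ t in p.1..p.2, f t * Complex.exp (-(Complex.I * (l : ℂ) * (t : ℂ))))
    (comap (fun p : ℝ × ℝ => p.2 - p.1) atTop) (𝓝 c)

/-! ### Fourier–Bohr coefficients at negative frequencies -/

/-! For `l < 0` the factor `e^{-ilz}` decays upwards, so Cauchy's theorem on tall rectangles bounds
the integrals of `f* e^{-ilt}` over all intervals by one constant (`norm_integral_mul_exp_le`);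
dividing by the length kills the coefficient.

For `f* ∈ AP⁺`, a Bochner–Fejér argument: averaging `f*` against a nonnegative kernel with
frequencies in `S - S` gives a trigonometric polynomial whose coefficients are means of `f*`. If the
finite set `S` is almost invariant under the frequencies of a polynomial `Q` near `f*`, the average
almost fixes `Q`, hence `f*`. Such an `S` exists because finitely generated abelian groups grow
polynomially (`exists_one_sub_le_overlap`). Terms of negative frequency have small coefficients and
are dropped.

Nonnegative frequencies make the approximant bounded on the upper half-plane, so Phragmén–Lindelöf
carries the estimate from the line to `f`. -/

theorem norm_exp_neg_I_mul (l : ℝ) (z : ℂ) :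
    ‖Complex.exp (-(Complex.I * l * z))‖ = Real.exp (l * z.im) := by
  rw [Complex.norm_exp]
  simp

theorem norm_exp_I_mul_real (l t : ℝ) : ‖Complex.exp (Complex.I * l * t)‖ = 1 := by
  rw [Complex.norm_exp]
  simp

theorem norm_integral_mul_exp_le {F : ℂ → ℂ} {M : ℝ} (hc : ContinuousOn F {z : ℂ | 0 ≤ z.im})
    (hd : DifferentiableOn ℂ F {z : ℂ | 0 < z.im}) (hM : ∀ z : ℂ, 0 < z.im → ‖F z‖ ≤ M)
    {l : ℝ} (hl : l < 0) {a b : ℝ} (hab : a ≤ b) :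
    ‖∫ t in a..b, F t * Complex.exp (-(Complex.I * (l : ℂ) * (t : ℂ)))‖ ≤ 2 * (M / -l) := by
  have hM0 : 0 ≤ M := (norm_nonneg _).trans (hM Complex.I (by simp))
  set g : ℂ → ℂ := fun z => F z * Complex.exp (-(Complex.I * (l : ℂ) * z)) with hg
  have hgc : ContinuousOn g {z : ℂ | 0 ≤ z.im} := hc.mul (by fun_prop)
  have hgd : DifferentiableOn ℂ g {z : ℂ | 0 < z.im} := hd.mul (by fun_prop)
  have hgM (z : ℂ) (hz : 0 < z.im) : ‖g z‖ ≤ M * Real.exp (l * z.im) := by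
    rw [hg, norm_mul, norm_exp_neg_I_mul]
    exact mul_le_mul_of_nonneg_right (hM z hz) (Real.exp_nonneg _)
  have hside (c Y : ℝ) (hY : 0 < Y) :
      ‖∫ y in (0 : ℝ)..Y, g (c + y * Complex.I)‖ ≤ M / -l := by
    have hint : ∫ y in (0 : ℝ)..Y, M * Real.exp (l * y) = M * ((Real.exp (l * Y) - 1) / l) := by
      rw [intervalIntegral.integral_const_mul]
      congr 1
      rw [intervalIntegral.integral_comp_mul_left (fun y => Real.exp y) hl.ne, integral_exp]
      simp [div_eq_inv_mul]
    refine (intervalIntegral.norm_integral_le_of_norm_le (g := fun y => M * Real.exp (l * y))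
      hY.le (.of_forall fun y hy => ?_) (by apply Continuous.intervalIntegrable; fun_prop)).trans ?_
    · simpa using hgM (c + y * Complex.I) (by simpa using hy.1)
    · rw [hint, div_eq_mul_inv M]
      refine mul_le_mul_of_nonneg_left ?_ hM0
      rw [← neg_div_neg_eq, ← one_div]
      have := Real.exp_pos (l * Y)
      have : 0 < -l := by linarith
      gcongr
      linarith
  have hmain (Y : ℝ) (hY : 0 < Y) : ‖∫ t in a..b, g t‖ ≤
      M * Real.exp (l * Y) * (b - a) + 2 * (M / -l) := by
    have h := Complex.integral_boundary_rect_eq_zero_of_continuousOn_of_differentiableOn g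
      (a : ℂ) (b + Y * Complex.I) (hgc.mono ?_) (hgd.mono ?_)
    · simp only [Complex.ofReal_re, Complex.add_re, Complex.mul_re, Complex.I_re, mul_zero,
        Complex.ofReal_im, Complex.I_im, sub_self, add_zero, zero_mul, Complex.add_im,
        Complex.mul_im, mul_one, zero_add, Complex.ofReal_zero, smul_eq_mul] at h
      have htop : ‖∫ x in a..b, g (x + Y * Complex.I)‖ ≤ M * Real.exp (l * Y) * (b - a) := by
        refine (intervalIntegral.norm_integral_le_of_norm_le_const
          (C := M * Real.exp (l * Y)) fun x _ => ?_).trans_eq (by rw [abs_of_nonneg (by linarith)])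
        simpa using hgM (x + Y * Complex.I) (by simpa using hY)
      have heq : ∫ t in a..b, g t = (∫ x in a..b, g (x + Y * Complex.I)) -
          Complex.I * (∫ y in (0 : ℝ)..Y, g (b + y * Complex.I)) +
          Complex.I * (∫ y in (0 : ℝ)..Y, g (a + y * Complex.I)) := by
        linear_combination h
      rw [heq]
      refine (norm_add_le _ _).trans ((add_le_add_left (norm_sub_le _ _) _).trans ?_)
      simp only [norm_mul, Complex.norm_I, one_mul]
      linarith [hside a Y hY, hside b Y hY]
    · intro z hz
      have := hz.2
      simp [Set.uIcc_of_le hY.le] at this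
      exact this.1
    · intro z hz
      have := hz.2
      simp [min_eq_left hY.le] at this
      exact this.1
  -- Raising the top side removes the only term depending on `b - a`.
  have hlim : Tendsto (fun Y : ℝ => M * Real.exp (l * Y) * (b - a) + 2 * (M / -l)) atTop
      (𝓝 (M * 0 * (b - a) + 2 * (M / -l))) := by
    refine (((Real.tendsto_exp_atBot.comp ?_).const_mul M).mul_const (b - a)).add_const _
    exact tendsto_id.const_mul_atTop_of_neg hl
  simpa using ge_of_tendsto hlim ((eventually_gt_atTop 0).mono hmain)

theorem hasFourierBohrCoeff_zero_of_norm_integral_le {f : ℝ → ℂ} {l C : ℝ}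
    (h : ∀ a b : ℝ, a ≤ b →
      ‖∫ t in a..b, f t * Complex.exp (-(Complex.I * (l : ℂ) * (t : ℂ)))‖ ≤ C) :
    HasFourierBohrCoeff f l 0 := by
  have hlim : Tendsto (fun p : ℝ × ℝ => (p.2 - p.1)⁻¹ * C)
      (comap (fun p : ℝ × ℝ => p.2 - p.1) atTop) (𝓝 0) := by
    simpa using (tendsto_inv_atTop_zero.comp tendsto_comap).mul_const C
  refine squeeze_zero_norm' ?_ hlim
  filter_upwards [tendsto_comap.eventually (eventually_gt_atTop (0 : ℝ))] with p hp
  rw [norm_mul, Complex.norm_real, Real.norm_of_nonneg (inv_nonneg.2 hp.le)]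
  exact mul_le_mul_of_nonneg_left (h _ _ (by linarith)) (inv_nonneg.2 hp.le)

theorem differentiableOn_of_mem_HInfty {f : ℍ →ᵇ ℂ} (hf : f ∈ HInfty) {F : ℂ → ℂ}
    (hF : ∀ z : ℍ, F z = f z) : DifferentiableOn ℂ F {z : ℂ | 0 < z.im} := by
  refine (UpperHalfPlane.mdifferentiable_iff.1 hf).congr fun z hz => ?_
  simpa [UpperHalfPlane.ofComplex_apply_of_im_pos hz] using hF ⟨z, hz⟩

theorem norm_le_of_extends {f : ℍ →ᵇ ℂ} {F : ℂ → ℂ} (hF : ∀ z : ℍ, F z = f z) {z : ℂ}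
    (hz : 0 < z.im) : ‖F z‖ ≤ ‖f‖ := by
  simpa [← hF ⟨z, hz⟩] using f.norm_coe_le_norm ⟨z, hz⟩

/-! ### The maximum principle in the upper half-plane -/

theorem norm_le_of_norm_le_on_real {F : ℂ → ℂ} {M C : ℝ}
    (hc : ContinuousOn F {z : ℂ | 0 ≤ z.im}) (hd : DifferentiableOn ℂ F {z : ℂ | 0 < z.im})
    (hM : ∀ z : ℂ, 0 < z.im → ‖F z‖ ≤ M) (hC : ∀ x : ℝ, ‖F x‖ ≤ C) {z : ℂ} (hz : 0 < z.im) :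
    ‖F z‖ ≤ C := by
  have hcl : closure {z : ℂ | 0 < z.re} = {z : ℂ | 0 ≤ z.re} := Complex.closure_setOfPred_lt_re 0
  -- The rotation `w ↦ iw` takes the right half-plane to the upper one. Boundedness is growth of
  -- order `exp (0 * ‖w‖ ^ 0)`, hence the two zeros.
  have key := PhragmenLindelof.right_half_plane_of_bounded_on_real (C := C)
    (f := fun w => F (Complex.I * w)) (z := -Complex.I * z) ⟨?_, ?_⟩ ⟨0, by norm_num, 0, ?_⟩ ?_ ?_ ?_
  · simpa [← mul_assoc] using key
  · exact hd.comp (by fun_prop) fun w hw => by simpa using hw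
  · rw [hcl]
    exact hc.comp (by fun_prop) fun w hw => by simpa using hw
  · refine Asymptotics.IsBigO.of_bound M ?_
    filter_upwards [mem_inf_of_right (mem_principal_self _)] with w hw
    simpa using hM (Complex.I * w) (by simpa using hw)
  · refine isBoundedUnder_of_eventually_le (a := M) ?_
    filter_upwards [eventually_gt_atTop 0] with x hx
    exact hM _ (by simpa using hx)
  · intro x
    have : Complex.I * (x * Complex.I) = ((-x : ℝ) : ℂ) := by
      push_cast
      linear_combination (x : ℂ) * Complex.I_mul_I
    simpa [this] using hC (-x)
  · simpa using hz.le

/-! ### Følner sets in commutative groups -/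

section Folner

variable {G : Type*} [AddCommGroup G] [DecidableEq G]

/-- The set of all combinations `∑ nᵢ • i` of the elements of `L` with coefficients
`0 ≤ nᵢ ≤ k`. -/
def boxCombinations (L : Finset G) (k : ℕ) : Finset G :=
  (Fintype.piFinset fun _ : L => Finset.range (k + 1)).image fun n => ∑ i : L, n i • (i : G)

theorem mem_boxCombinations {L : Finset G} {k : ℕ} {g : G} :
    g ∈ boxCombinations L k ↔ ∃ n : L → ℕ, (∀ i, n i ≤ k) ∧ ∑ i : L, n i • (i : G) = g := by
  simp only [boxCombinations, Finset.mem_image, Fintype.mem_piFinset, Finset.mem_range,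
    Nat.lt_succ_iff]

theorem boxCombinations_mono (L : Finset G) : Monotone (boxCombinations L) := by
  intro j k hjk g hg
  obtain ⟨n, hn, rfl⟩ := mem_boxCombinations.1 hg
  exact mem_boxCombinations.2 ⟨n, fun i => (hn i).trans hjk, rfl⟩

theorem add_mem_boxCombinations {L : Finset G} {k : ℕ} {g x : G} (hg : g ∈ boxCombinations L k)
    (hx : x ∈ L) : g + x ∈ boxCombinations L (k + 1) := by
  obtain ⟨n, hn, rfl⟩ := mem_boxCombinations.1 hg
  refine mem_boxCombinations.2 ⟨n + Pi.single ⟨x, hx⟩ 1, fun i => ?_, ?_⟩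
  · refine add_le_add (hn i) ?_
    by_cases h : i = ⟨x, hx⟩
    · simp [h]
    · simp [Pi.single_eq_of_ne h]
  · simp only [Pi.add_apply, add_smul, Finset.sum_add_distrib]
    congr 1
    rw [Finset.sum_eq_single ⟨x, hx⟩]
    · simp
    · intro i _ h
      simp [Pi.single_eq_of_ne h]
    · simp

theorem card_boxCombinations_le (L : Finset G) (k : ℕ) :
    (boxCombinations L k).card ≤ (k + 1) ^ L.card := by
  refine Finset.card_image_le.trans ?_
  simp

theorem boxCombinations_nonempty (L : Finset G) (k : ℕ) : (boxCombinations L k).Nonempty :=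
  ⟨0, mem_boxCombinations.2 ⟨fun _ => 0, by simp⟩⟩

/-- Otherwise the boxes would grow at least like `(1 + δ) ^ k`, against the polynomial bound `(k +
1) ^ L.card`. -/
theorem exists_card_boxCombinations_succ_le (L : Finset G) {δ : ℝ} (hδ : 0 < δ) :
    ∃ k, ((boxCombinations L (k + 1)).card : ℝ) ≤ (1 + δ) * (boxCombinations L k).card := by
  by_contra! h
  have hexp (k : ℕ) : (1 + δ) ^ k ≤ ((boxCombinations L k).card : ℝ) := by
    induction k with
    | zero => simpa [Nat.one_le_iff_ne_zero] using (boxCombinations_nonempty L 0).ne_empty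
    | succ k ih =>
      rw [pow_succ']
      exact (mul_le_mul_of_nonneg_left ih (by positivity)).trans (h k).le
  have hlim := ((tendsto_pow_const_div_const_pow_of_one_lt L.card
    (show 1 < 1 + δ by linarith)).comp (tendsto_add_atTop_nat 1)).const_mul (1 + δ)
  have hone (k : ℕ) : 1 ≤ (1 + δ) * ((((k + 1 : ℕ) : ℝ)) ^ L.card / (1 + δ) ^ (k + 1)) := by
    have h1 : (1 + δ) ^ k ≤ ((k + 1 : ℕ) : ℝ) ^ L.card :=
      (hexp k).trans (by exact_mod_cast card_boxCombinations_le L k)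
    have h2 : (1 + δ) * ((((k + 1 : ℕ) : ℝ)) ^ L.card / (1 + δ) ^ (k + 1)) =
        ((k + 1 : ℕ) : ℝ) ^ L.card / (1 + δ) ^ k := by
      field_simp
      ring
    rw [h2, one_le_div (by positivity)]
    exact h1
  have := ge_of_tendsto' hlim hone
  norm_num at this

/-- The proportion of the elements of `S` that lie in the translate of `S` by `g`. -/
noncomputable def overlap (S : Finset G) (g : G) : ℝ :=
  (S.card : ℝ)⁻¹ * ((S ×ˢ S).filter fun p => p.1 - p.2 = g).card

theorem card_filter_sub_eq (S : Finset G) (g : G) :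
    ((S ×ˢ S).filter fun p => p.1 - p.2 = g).card = (S.filter fun s => s + g ∈ S).card := by
  refine Finset.card_bij' (fun p _ => p.2) (fun s _ => (s + g, s)) ?_ ?_ ?_ ?_
  · rintro ⟨a, b⟩ h
    simp only [Finset.mem_filter, Finset.mem_product] at h ⊢
    obtain ⟨⟨ha, hb⟩, rfl⟩ := h
    simpa [hb] using ha
  · intro s h
    simp only [Finset.mem_filter, Finset.mem_product] at h ⊢
    simp [h.1, h.2]
  · rintro ⟨a, b⟩ h
    simp only [Finset.mem_filter] at h
    simp [← h.2]
  · simp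

theorem overlap_le_one (S : Finset G) (g : G) : overlap S g ≤ 1 := by
  rw [overlap, card_filter_sub_eq]
  refine inv_mul_le_one_of_le₀ ?_ (by positivity)
  exact_mod_cast Finset.card_filter_le _ _

theorem overlap_zero {S : Finset G} (hS : S.Nonempty) : overlap S 0 = 1 := by
  have : (S.card : ℝ) ≠ 0 := by simpa using hS.ne_empty
  rw [overlap, card_filter_sub_eq]
  simp [this]

/-- A translate by `g ∈ L` of a box stays in the next box, which has at most `δ * S.card` points
outside `S`; so at most that many points leave `S`. -/
theorem exists_one_sub_le_overlap (L : Finset G) {δ : ℝ} (hδ : 0 < δ) :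
    ∃ S : Finset G, S.Nonempty ∧ ∀ g ∈ L, 1 - δ ≤ overlap S g := by
  obtain ⟨k, hk⟩ := exists_card_boxCombinations_succ_le L hδ
  refine ⟨boxCombinations L k, boxCombinations_nonempty L k, fun g hg => ?_⟩
  set S := boxCombinations L k
  have hpos : 0 < (S.card : ℝ) := by exact_mod_cast (boxCombinations_nonempty L k).card_pos
  rw [overlap, card_filter_sub_eq, inv_mul_eq_div, le_div_iff₀ hpos]
  have hout : S.card + (S.filter fun s => s + g ∉ S).card ≤ (boxCombinations L (k + 1)).card := by
    rw [← Finset.card_image_of_injective (S.filter fun s => s + g ∉ S) (add_left_injective g),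
      ← Finset.card_union_of_disjoint]
    · refine Finset.card_le_card (Finset.union_subset (boxCombinations_mono L k.le_succ) ?_)
      intro x hx
      obtain ⟨s, hs, rfl⟩ := Finset.mem_image.1 hx
      exact add_mem_boxCombinations (Finset.mem_filter.1 hs).1 hg
    · rw [Finset.disjoint_right]
      intro x hx
      obtain ⟨s, hs, rfl⟩ := Finset.mem_image.1 hx
      exact (Finset.mem_filter.1 hs).2
  have hsplit := S.card_filter_add_card_filter_not (fun s => s + g ∈ S)
  have h1 : (S.card : ℝ) + ((S.filter fun s => s + g ∉ S).card : ℝ) ≤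
      (boxCombinations L (k + 1)).card := by exact_mod_cast hout
  have h2 : ((S.filter fun s => s + g ∈ S).card : ℝ) + ((S.filter fun s => s + g ∉ S).card : ℝ) =
      S.card := by exact_mod_cast hsplit
  linarith

end Folner

/-! ### Means over `[0, T]` and Fejér type kernels -/

/-- The mean of `g` over `[0, T]`. -/
noncomputable def mean (T : ℝ) (g : ℝ → ℂ) : ℂ := ((T⁻¹ : ℝ) : ℂ) * ∫ t in (0 : ℝ)..T, g t

theorem mean_const_mul (T : ℝ) (c : ℂ) (g : ℝ → ℂ) :
    mean T (fun t => c * g t) = c * mean T g := by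
  rw [mean, mean, intervalIntegral.integral_const_mul, mul_left_comm]

theorem mean_sum {ι : Type*} (s : Finset ι) (T : ℝ) {g : ι → ℝ → ℂ}
    (hg : ∀ i ∈ s, Continuous (g i)) :
    mean T (fun t => ∑ i ∈ s, g i t) = ∑ i ∈ s, mean T (g i) := by
  simp only [mean]
  rw [intervalIntegral.integral_finsetSum fun i hi => (hg i hi).intervalIntegrable _ _,
    Finset.mul_sum]

theorem mean_add (T : ℝ) {g h : ℝ → ℂ} (hg : Continuous g) (hh : Continuous h) :
    mean T (fun t => g t + h t) = mean T g + mean T h := by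
  simp only [mean]
  rw [intervalIntegral.integral_add (hg.intervalIntegrable _ _) (hh.intervalIntegrable _ _),
    mul_add]

theorem norm_mean_le_of_norm_le {T : ℝ} (hT : 0 < T) {g : ℝ → ℂ} {h : ℝ → ℝ}
    (hh : Continuous h) (hgh : ∀ t, ‖g t‖ ≤ h t) :
    ‖mean T g‖ ≤ ‖mean T (fun t => (h t : ℂ))‖ := by
  have h1 : ‖∫ t in (0 : ℝ)..T, g t‖ ≤ ∫ t in (0 : ℝ)..T, h t :=
    intervalIntegral.norm_integral_le_of_norm_le hT.le (.of_forall fun t _ => hgh t)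
      (hh.intervalIntegrable _ _)
  rw [mean, mean, intervalIntegral.integral_ofReal, norm_mul, norm_mul, Complex.norm_real,
    Complex.norm_real]
  exact mul_le_mul_of_nonneg_left (h1.trans (le_abs_self _)) (norm_nonneg _)

theorem HasFourierBohrCoeff.tendsto_mean {f : ℝ → ℂ} {l : ℝ} {c : ℂ}
    (h : HasFourierBohrCoeff f l c) :
    Tendsto (fun T => mean T fun t => f t * Complex.exp (-(Complex.I * (l : ℂ) * (t : ℂ)))) atTop
      (𝓝 c) := by
  have hmap : Tendsto (fun T : ℝ => ((0 : ℝ), T)) atTop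
      (comap (fun p : ℝ × ℝ => p.2 - p.1) atTop) :=
    tendsto_comap_iff.2 <| by
      simp only [Function.comp_def, sub_zero]
      exact tendsto_id
  simpa [mean, Function.comp_def] using Tendsto.comp h hmap

theorem tendsto_mean_exp (l : ℝ) :
    Tendsto (fun T => mean T fun t => Complex.exp (Complex.I * (l : ℂ) * (t : ℂ))) atTop
      (𝓝 (if l = 0 then 1 else 0)) := by
  split_ifs with hl
  · subst hl
    refine tendsto_const_nhds.congr' ?_
    filter_upwards [eventually_gt_atTop 0] with T hT
    simp [mean, hT.ne']
  · have hne : Complex.I * (l : ℂ) ≠ 0 := by simpa using hl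
    have hlim : Tendsto (fun T : ℝ => T⁻¹ * (2 / |l|)) atTop (𝓝 0) := by
      simpa using tendsto_inv_atTop_zero.mul_const (2 / |l|)
    refine squeeze_zero_norm' ?_ hlim
    filter_upwards [eventually_gt_atTop 0] with T hT
    rw [mean, integral_exp_mul_complex hne, norm_mul, Complex.norm_real,
      Real.norm_of_nonneg (inv_nonneg.2 hT.le), norm_div]
    refine mul_le_mul_of_nonneg_left ?_ (inv_nonneg.2 hT.le)
    have h2 : ‖Complex.exp (Complex.I * l * T) - Complex.exp (Complex.I * l * (0 : ℝ))‖ ≤ 2 := by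
      refine (norm_sub_le _ _).trans_eq ?_
      simp only [Complex.norm_exp]
      norm_num
    simpa using div_le_div_of_nonneg_right h2 (abs_nonneg l)

/-- The Fejér type kernel `u ↦ |S|⁻¹ |∑_{s ∈ S} e^{isu}|²` of a finite set `S` of frequencies. -/
noncomputable def fejerKernel (S : Finset ℝ) (u : ℝ) : ℝ :=
  (S.card : ℝ)⁻¹ * ‖∑ s ∈ S, Complex.exp (Complex.I * (s : ℂ) * (u : ℂ))‖ ^ 2

theorem fejerKernel_nonneg (S : Finset ℝ) (u : ℝ) : 0 ≤ fejerKernel S u := by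
  unfold fejerKernel; positivity

@[fun_prop]
theorem continuous_fejerKernel (S : Finset ℝ) : Continuous (fejerKernel S) := by
  unfold fejerKernel; fun_prop

theorem fejerKernel_eq_sum (S : Finset ℝ) (u : ℝ) :
    (fejerKernel S u : ℂ) = ∑ p ∈ S ×ˢ S,
      (S.card : ℂ)⁻¹ * Complex.exp (Complex.I * ((p.1 - p.2 : ℝ) : ℂ) * (u : ℂ)) := by
  rw [fejerKernel, ← Finset.mul_sum]
  push_cast
  rw [← Complex.mul_conj', map_sum, Finset.sum_mul_sum, Finset.sum_product]
  congr 1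
  refine Finset.sum_congr rfl fun s _ => Finset.sum_congr rfl fun s' _ => ?_
  rw [← Complex.exp_conj, ← Complex.exp_add]
  congr 1
  simp
  ring

/-- The variable `x` separates from `t` in each exponential of the kernel, so the average is a
trigonometric polynomial in `x` for every `T`, before any limit. -/
theorem mean_mul_fejerKernel (S : Finset ℝ) {g : ℝ → ℂ} (hg : Continuous g) (T x : ℝ) :
    mean T (fun t => g t * (fejerKernel S (x - t) : ℂ)) = ∑ p ∈ S ×ˢ S,
      (S.card : ℂ)⁻¹ *
        mean T (fun t => g t * Complex.exp (-(Complex.I * ((p.1 - p.2 : ℝ) : ℂ) * (t : ℂ)))) *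
        Complex.exp (Complex.I * ((p.1 - p.2 : ℝ) : ℂ) * (x : ℂ)) := by
  simp only [fejerKernel_eq_sum, Finset.mul_sum]
  rw [mean_sum _ _ fun p _ => by fun_prop]
  refine Finset.sum_congr rfl fun p _ => ?_
  rw [mul_right_comm, ← mean_const_mul]
  congr 1
  ext t
  have : Complex.exp (Complex.I * ((p.1 - p.2 : ℝ) : ℂ) * ((x - t : ℝ) : ℂ)) =
      Complex.exp (Complex.I * ((p.1 - p.2 : ℝ) : ℂ) * x) *
        Complex.exp (-(Complex.I * ((p.1 - p.2 : ℝ) : ℂ) * t)) := by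
    rw [← Complex.exp_add]
    congr 1
    push_cast
    ring
  rw [this]
  ring

theorem norm_sum_mul_exp_le {ι : Type*} (s : Finset ι) (a : ι → ℂ) (l : ι → ℝ) (x : ℝ) :
    ‖∑ i ∈ s, a i * Complex.exp (Complex.I * (l i : ℂ) * (x : ℂ))‖ ≤ ∑ i ∈ s, ‖a i‖ := by
  refine (norm_sum_le _ _).trans (Finset.sum_le_sum fun i _ => ?_)
  rw [norm_mul, Complex.norm_exp]
  simp

/-- In the limit only the pairs of difference `l` survive, which leaves the factor `overlap S l`.
Uniformity in `x` holds because the error is a trigonometric polynomial whose coefficients do not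
depend on `x`. -/
theorem eventually_norm_mean_exp_mul_fejerKernel_sub_le (S : Finset ℝ) (l : ℝ) {η : ℝ}
    (hη : 0 < η) : ∀ᶠ T in atTop, ∀ x : ℝ,
      ‖mean T (fun t => Complex.exp (Complex.I * (l : ℂ) * (t : ℂ)) *
          (fejerKernel S (x - t) : ℂ)) -
        overlap S l * Complex.exp (Complex.I * (l : ℂ) * (x : ℂ))‖ ≤ η := by
  have hlim : Tendsto (fun T => ∑ p ∈ S ×ˢ S, ‖(S.card : ℂ)⁻¹ *
      (mean T (fun t => Complex.exp (Complex.I * ((l - (p.1 - p.2) : ℝ) : ℂ) * (t : ℂ))) -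
        if l - (p.1 - p.2) = 0 then 1 else 0)‖) atTop (𝓝 0) := by
    rw [← Finset.sum_const_zero (s := S ×ˢ S)]
    refine tendsto_finsetSum _ fun p _ => ?_
    simpa using (((tendsto_mean_exp (l - (p.1 - p.2))).sub_const
      (if l - (p.1 - p.2) = 0 then 1 else 0)).const_mul (S.card : ℂ)⁻¹).norm
  filter_upwards [hlim.eventually_le_const hη] with T hT x
  refine le_trans (le_of_eq_of_le ?_ (norm_sum_mul_exp_le (S ×ˢ S) _ (fun p => p.1 - p.2) x)) hT
  rw [mean_mul_fejerKernel S (by fun_prop)]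
  have hov : (overlap S l : ℂ) * Complex.exp (Complex.I * (l : ℂ) * (x : ℂ)) =
      ∑ p ∈ S ×ˢ S, (S.card : ℂ)⁻¹ * (if l - (p.1 - p.2) = 0 then 1 else 0) *
        Complex.exp (Complex.I * ((p.1 - p.2 : ℝ) : ℂ) * (x : ℂ)) := by
    rw [overlap, Finset.card_filter]
    push_cast
    rw [Finset.mul_sum, Finset.sum_mul]
    refine Finset.sum_congr rfl fun p _ => ?_
    by_cases h : p.1 - p.2 = l
    · simp [← h]
    · have h' : l - (p.1 - p.2) ≠ 0 := fun h0 => h (by linarith)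
      simp [h, h']
  rw [hov, ← Finset.sum_sub_distrib]
  congr 1
  refine Finset.sum_congr rfl fun p _ => ?_
  rw [mul_sub, sub_mul]
  congr 4
  ext t
  rw [← Complex.exp_add]
  congr 1
  push_cast
  ring

/-! ### Approximation by trigonometric polynomials with nonnegative frequencies -/

theorem exists_trigPoly_near_of_mem_AP {f : ℝ →ᵇ ℂ} (hf : f ∈ AP)
    (hneg : ∀ l : ℝ, l < 0 → HasFourierBohrCoeff f l 0) {ε : ℝ} (hε : 0 < ε) :
    ∃ (n : ℕ) (a : Fin n → ℂ) (l : Fin n → ℝ), (∀ j, 0 ≤ l j) ∧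
      ∀ x : ℝ, ‖f x - ∑ j, a j * Complex.exp (Complex.I * (l j : ℂ) * (x : ℂ))‖ ≤ 6 * ε := by
  obtain ⟨Q, ⟨n, a, l, hQ⟩, hfQ⟩ := Metric.mem_closure_iff.1 hf ε hε
  have hfQ' (t : ℝ) : ‖f t - Q t‖ ≤ ε := by
    rw [← dist_eq_norm]
    exact (BoundedContinuousFunction.dist_coe_le_dist t).trans hfQ.le
  set A : ℝ := ∑ j, ‖a j‖ with hA
  have hA0 : 0 ≤ A := Finset.sum_nonneg fun _ _ => norm_nonneg _
  -- The `+ 1` covers `A = 0`.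
  set δ : ℝ := ε / (A + 1) with hδ
  have hδ0 : 0 < δ := by positivity
  have hAδ : A * δ ≤ ε := by
    rw [hδ, mul_div_assoc', div_le_iff₀ (by positivity)]
    nlinarith
  obtain ⟨S, hS, hov⟩ := exists_one_sub_le_overlap (Finset.univ.image l) hδ0
  have hovl (j : Fin n) : ‖(overlap S (l j) : ℂ) - 1‖ ≤ δ := by
    have h1 := hov (l j) (Finset.mem_image_of_mem l (Finset.mem_univ j))
    have h2 := overlap_le_one S (l j)
    rw [← Complex.ofReal_one, ← Complex.ofReal_sub, Complex.norm_real, Real.norm_eq_abs, abs_le]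
    constructor <;> linarith
  set c : ℝ → ℝ × ℝ → ℂ := fun T p => (S.card : ℂ)⁻¹ *
    mean T (fun t => f t * Complex.exp (-(Complex.I * ((p.1 - p.2 : ℝ) : ℂ) * (t : ℂ)))) with hc
  have hnegT : Tendsto (fun T => ∑ p ∈ (S ×ˢ S).filter fun p => ¬ 0 ≤ p.1 - p.2, ‖c T p‖)
      atTop (𝓝 0) := by
    have h : ∀ p ∈ (S ×ˢ S).filter fun p => ¬ 0 ≤ p.1 - p.2,
        Tendsto (fun T => ‖c T p‖) atTop (𝓝 0) := fun p hp => by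
      have hp' : p.1 - p.2 < 0 := not_le.1 (Finset.mem_filter.1 hp).2
      simpa [hc] using ((hneg _ hp').tendsto_mean.const_mul (S.card : ℂ)⁻¹).norm
    simpa only [Finset.sum_const_zero] using tendsto_finsetSum _ h
  -- Finitely many conditions, so one finite `T` meets them all; no limit of the means of `f` at
  -- nonnegative frequencies is needed. Frequency `0` controls the mass of the kernel.
  obtain ⟨T, hT0, hTneg, hTone, hTl⟩ := ((eventually_gt_atTop (0 : ℝ)).and
    ((hnegT.eventually_le_const hε).and
    ((eventually_norm_mean_exp_mul_fejerKernel_sub_le S 0 one_pos).and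
    (eventually_all.2 fun j => eventually_norm_mean_exp_mul_fejerKernel_sub_le S (l j)
      hδ0)))).exists
  set K : ℝ → ℝ → ℂ := fun x t => (fejerKernel S (x - t) : ℂ) with hK
  have hmeanK (x : ℝ) : ‖mean T (K x)‖ ≤ 2 := by
    have := hTone x
    simp only [Complex.ofReal_zero, mul_zero, zero_mul, Complex.exp_zero, one_mul,
      overlap_zero hS, Complex.ofReal_one] at this
    calc ‖mean T (K x)‖ = ‖(mean T (K x) - 1) + 1‖ := by rw [sub_add_cancel]
      _ ≤ 1 + 1 := (norm_add_le _ _).trans (by simpa using this)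
      _ = 2 := by norm_num
  have hdiff (x : ℝ) : ‖mean T (fun t => (f t - Q t) * K x t)‖ ≤ 2 * ε := by
    have h1 := norm_mean_le_of_norm_le hT0 (g := fun t => (f t - Q t) * K x t)
      (h := fun t => ε * fejerKernel S (x - t)) (by fun_prop) fun t => by
        rw [norm_mul, hK, Complex.norm_real, Real.norm_of_nonneg (fejerKernel_nonneg _ _)]
        exact mul_le_mul_of_nonneg_right (hfQ' t) (fejerKernel_nonneg _ _)
    simp only [Complex.ofReal_mul] at h1
    rw [mean_const_mul, norm_mul, Complex.norm_real, Real.norm_of_nonneg hε.le] at h1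
    have := mul_le_mul_of_nonneg_left (hmeanK x) hε.le
    linarith
  have hmeanQ (x : ℝ) : ‖mean T (fun t => Q t * K x t) - Q x‖ ≤ 2 * ε := by
    have h1 : mean T (fun t => Q t * K x t) - Q x = ∑ j, a j *
        ((mean T (fun t => Complex.exp (Complex.I * (l j : ℂ) * (t : ℂ)) * K x t) -
          overlap S (l j) * Complex.exp (Complex.I * (l j : ℂ) * (x : ℂ))) +
        (overlap S (l j) - 1) * Complex.exp (Complex.I * (l j : ℂ) * (x : ℂ))) := by
      simp only [hQ, Finset.sum_mul, mul_assoc (a _)]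
      rw [mean_sum _ _ fun j _ => by fun_prop, ← Finset.sum_sub_distrib]
      refine Finset.sum_congr rfl fun j _ => ?_
      rw [mean_const_mul]
      ring
    have h2 (j : Fin n) : ‖a j *
        ((mean T (fun t => Complex.exp (Complex.I * (l j : ℂ) * (t : ℂ)) * K x t) -
          overlap S (l j) * Complex.exp (Complex.I * (l j : ℂ) * (x : ℂ))) +
        (overlap S (l j) - 1) * Complex.exp (Complex.I * (l j : ℂ) * (x : ℂ)))‖ ≤
        ‖a j‖ * (δ + δ) := by
      rw [norm_mul]
      refine mul_le_mul_of_nonneg_left ((norm_add_le _ _).trans (add_le_add (hTl j x) ?_))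
        (norm_nonneg _)
      rw [norm_mul, norm_exp_I_mul_real, mul_one]
      exact hovl j
    rw [h1]
    refine (norm_sum_le _ _).trans ((Finset.sum_le_sum fun j _ => h2 j).trans ?_)
    rw [← Finset.sum_mul, ← hA]
    linarith
  have hfull (x : ℝ) : mean T (fun t => f t * K x t) =
      ∑ p ∈ S ×ˢ S, c T p * Complex.exp (Complex.I * ((p.1 - p.2 : ℝ) : ℂ) * (x : ℂ)) :=
    mean_mul_fejerKernel S f.continuous T x
  -- The `5` is `1` for `f - Q`, `2` for its average and `2` for the averaging error on `Q`; the
  -- discarded negative frequencies add the sixth `ε`.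
  have hnear (x : ℝ) : ‖f x - mean T (fun t => f t * K x t)‖ ≤ 5 * ε := by
    have hsplit : mean T (fun t => f t * K x t) =
        mean T (fun t => (f t - Q t) * K x t) + mean T (fun t => Q t * K x t) := by
      rw [← mean_add _ (by fun_prop) (by fun_prop)]
      congr 1
      ext t
      ring
    have : f x - mean T (fun t => f t * K x t) = (f x - Q x) -
        mean T (fun t => (f t - Q t) * K x t) - (mean T (fun t => Q t * K x t) - Q x) := by
      rw [hsplit]
      ring
    rw [this]
    refine (norm_sub_le _ _).trans ?_
    linarith [norm_sub_le (f x - Q x) (mean T (fun t => (f t - Q t) * K x t)), hfQ' x, hdiff x,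
      hmeanQ x]
  set R := (S ×ˢ S).filter fun p => 0 ≤ p.1 - p.2 with hR
  let e := R.equivFin.symm
  refine ⟨R.card, fun j => c T (e j), fun j => (e j).1.1 - (e j).1.2,
    fun j => (Finset.mem_filter.1 (e j).2).2, fun x => ?_⟩
  have hreindex : ∑ j, c T (e j) *
      Complex.exp (Complex.I * (((e j).1.1 - (e j).1.2 : ℝ) : ℂ) * (x : ℂ)) =
      ∑ p ∈ R, c T p * Complex.exp (Complex.I * ((p.1 - p.2 : ℝ) : ℂ) * (x : ℂ)) := by
    rw [e.sum_comp fun p : R => c T p *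
      Complex.exp (Complex.I * ((p.1.1 - p.1.2 : ℝ) : ℂ) * (x : ℂ))]
    exact Finset.sum_coe_sort R fun p => c T p *
      Complex.exp (Complex.I * ((p.1 - p.2 : ℝ) : ℂ) * (x : ℂ))
  have hsum := Finset.sum_filter_add_sum_filter_not (S ×ˢ S) (fun p => 0 ≤ p.1 - p.2)
    fun p => c T p * Complex.exp (Complex.I * ((p.1 - p.2 : ℝ) : ℂ) * (x : ℂ))
  rw [← hfull, ← hR] at hsum
  rw [hreindex, eq_sub_of_add_eq hsum, sub_sub_eq_add_sub, add_sub_right_comm]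
  refine (norm_add_le _ _).trans ?_
  have := norm_sum_mul_exp_le ((S ×ˢ S).filter fun p => ¬ 0 ≤ p.1 - p.2) (c T)
    (fun p => p.1 - p.2) x
  linarith [hnear x]

theorem mem_APPlus_of_forall_near {f : ℝ →ᵇ ℂ}
    (h : ∀ ε > 0, ∃ (n : ℕ) (a : Fin n → ℂ) (l : Fin n → ℝ), (∀ j, 0 ≤ l j) ∧
      ∀ x : ℝ, ‖f x - ∑ j, a j * Complex.exp (Complex.I * (l j : ℂ) * (x : ℂ))‖ ≤ ε) :
    f ∈ APPlus := by
  refine Metric.mem_closure_iff.2 fun ε hε => ?_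
  obtain ⟨n, a, l, hl, hx⟩ := h (ε / 2) (by positivity)
  let Q : ℝ →ᵇ ℂ := BoundedContinuousFunction.ofNormedAddCommGroup
    (fun x : ℝ => ∑ j, a j * Complex.exp (Complex.I * (l j : ℂ) * (x : ℂ))) (by fun_prop)
    (∑ j, ‖a j‖) (norm_sum_mul_exp_le _ a l)
  refine ⟨Q, ⟨n, a, l, hl, fun t => rfl⟩, lt_of_le_of_lt ?_ (half_lt_self hε)⟩
  refine (BoundedContinuousFunction.dist_le (by positivity)).2 fun x => ?_
  rw [dist_eq_norm]
  exact hx x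

theorem norm_sum_mul_exp_le_of_im_nonneg {ι : Type*} (s : Finset ι) (a : ι → ℂ) {l : ι → ℝ}
    (hl : ∀ i, 0 ≤ l i) {z : ℂ} (hz : 0 ≤ z.im) :
    ‖∑ i ∈ s, a i * Complex.exp (Complex.I * (l i : ℂ) * z)‖ ≤ ∑ i ∈ s, ‖a i‖ := by
  refine (norm_sum_le _ _).trans (Finset.sum_le_sum fun i _ => ?_)
  rw [norm_mul, Complex.norm_exp]
  refine mul_le_of_le_one_right (norm_nonneg _) (Real.exp_le_one_iff.2 ?_)
  simpa using mul_nonneg (hl i) hz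

theorem mem_APPlusHol_of_forall_near {f : ℍ →ᵇ ℂ}
    (h : ∀ ε > 0, ∃ (n : ℕ) (a : Fin n → ℂ) (l : Fin n → ℝ), (∀ j, 0 ≤ l j) ∧
      ∀ z : ℍ, ‖f z - ∑ j, a j * Complex.exp (Complex.I * (l j : ℂ) * (z : ℂ))‖ ≤ ε) :
    f ∈ APPlusHol := by
  refine Metric.mem_closure_iff.2 fun ε hε => ?_
  obtain ⟨n, a, l, hl, hz⟩ := h (ε / 2) (by positivity)
  let q : ℍ →ᵇ ℂ := BoundedContinuousFunction.ofNormedAddCommGroup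
    (fun z : ℍ => ∑ j, a j * Complex.exp (Complex.I * (l j : ℂ) * (z : ℂ)))
    (by have := UpperHalfPlane.continuous_coe; fun_prop)
    (∑ j, ‖a j‖) (fun z => norm_sum_mul_exp_le_of_im_nonneg _ a hl z.2.le)
  refine ⟨q, ⟨n, a, l, hl, fun t => rfl⟩, lt_of_le_of_lt ?_ (half_lt_self hε)⟩
  refine (BoundedContinuousFunction.dist_le (by positivity)).2 fun z => ?_
  rw [dist_eq_norm]
  exact hz z

theorem mainTheorem6 (f : ℍ →ᵇ ℂ) (hf : f ∈ HInfty)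
    (fs : ℝ →ᵇ ℂ) (hext : IsBoundaryExtension f fs) (hfs : fs ∈ AP) :
    (∀ l : ℝ, l < 0 → HasFourierBohrCoeff fs l 0) ∧ fs ∈ APPlus ∧ f ∈ APPlusHol := by
  obtain ⟨F, hFc, hFf, hFfs⟩ := hext
  have hFd := differentiableOn_of_mem_HInfty hf hFf
  have hFM (z : ℂ) (hz : 0 < z.im) : ‖F z‖ ≤ ‖f‖ := norm_le_of_extends hFf hz
  have hneg (l : ℝ) (hl : l < 0) : HasFourierBohrCoeff fs l 0 :=
    hasFourierBohrCoeff_zero_of_norm_integral_le fun a b hab => by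
      simpa only [hFfs] using norm_integral_mul_exp_le hFc hFd hFM hl hab
  have hnear (ε : ℝ) (hε : 0 < ε) : ∃ (n : ℕ) (a : Fin n → ℂ) (l : Fin n → ℝ),
      (∀ j, 0 ≤ l j) ∧
      ∀ x : ℝ, ‖fs x - ∑ j, a j * Complex.exp (Complex.I * (l j : ℂ) * (x : ℂ))‖ ≤ ε := by
    simpa [mul_div_cancel₀] using
      exists_trigPoly_near_of_mem_AP hfs hneg (show 0 < ε / 6 by positivity)
  refine ⟨hneg, mem_APPlus_of_forall_near hnear, mem_APPlusHol_of_forall_near fun ε hε => ?_⟩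
  obtain ⟨n, a, l, hl, hx⟩ := hnear ε hε
  refine ⟨n, a, l, hl, fun z => ?_⟩
  rw [← hFf]
  -- This `M` serves only as an a priori bound; the estimate by `ε` comes from the real line.
  refine norm_le_of_norm_le_on_real (M := ‖f‖ + ∑ j, ‖a j‖)
    (F := fun w => F w - ∑ j, a j * Complex.exp (Complex.I * (l j : ℂ) * w))
    (hFc.sub (by fun_prop)) (hFd.sub (by fun_prop)) (fun w hw => ?_) (fun x => ?_) z.2
  · exact (norm_sub_le _ _).trans
      (add_le_add (hFM w hw) (norm_sum_mul_exp_le_of_im_nonneg _ a hl hw.le))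
  · simpa only [hFfs] using hx x
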